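/- Let $\mathcal X,\mathcal Y,\mathcal S$ be finite alphabets with $\mathcal X\neq\emptyset$, let $P_S$ be a probability distribution on $\mathcal S$, and let $\mathcal N(\cdot\mid x,s)$ be a probability distribution on $\mathcal Y$ for every $(x,s)\in\mathcal X\times\mathcal S$. For integers $M,n\ge 1$, a non-signaling-assisted (NS) coding scheme with non-causal CSIT is a conditional distribution $Z(x^n,\hat w\mid w,s^n,y^n)$ with $x^n\in\mathcal X^n$, $w,\hat w\in\{1,\dots,M\}$, $s^n\in\mathcal S^n$, $y^n\in\mathcal Y^n$, such that 1. the marginal $Z(x^n\mid w,s^n,y^n)$ does not depend on $y^n$; 2. the marginal $Z(\hat w\mid w,s^n,y^n)$ does not depend on $(w,s^n)$. It is an NS scheme with causal CSIT if moreover 3. for every $1\le i\le n-1$, the marginal $Z(x_1,\dots,x_i,\hat w\mid w,s^n,y^n)$ does not depend on $(s_{i+1},\dots,s_n)$. Its success probability is $$\eta(Z)=\frac1M\sum_{w}\sum_{x^n,s^n,y^n}\Big(\prod_{i=1}^nP_S(s_i)\,\mathcal N(y_i\mid x_i,s_i)\Big)Z(x^n,w\mid w,s^n,y^n).$$ A rate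 $R\ge0$ is achievable with causal (resp. non-causal) CSIT if there are NS schemes $Z_n$ with causal (resp. non-causal) CSIT, of blocklength $n$ and message size $M_n$, $n=1,2,\dots$, such that $\lim_n\eta(Z_n)=1$ and $\lim_n\frac1n\log_2M_n$ exists in $[0,\infty]$ and is at least $R$. The NS-assisted capacities $C^{\mathrm{NS,ca}}(\mathcal N,P_S)$ and $C^{\mathrm{NS,nc}}(\mathcal N,P_S)$ are the suprema of the rates achievable with causal and non-causal CSIT respectively. Let $\mathcal N^{\mathrm{CSIR}}$ be the channel with output $(Y,S)$, i.e. $\mathcal N^{\mathrm{CSIR}}((y,s')\mid x,s)=\mathcal N(y\mid x,s)\,\mathbb 1[s'=s]$. **Theorem.** The NS-assisted capacity with causal CSIT is $$C^{\mathrm{NS,ca}}(\mathcal N,P_S)=\max_{P_{X\mid S}}I(X;Y\mid S),$$ where the maximum (which is attained) is over all conditional distributions of $X$ given $S$, $(S,X,Y)\sim P_S(s)P_{X\mid S}(x\mid s)\mathcal N(y\mid x,s)$, and the mutual information is in bits. Moreover, causal CSIT is as good as non-causal CSIT, with or without the state at the receiver: $$C^{\mathrm{NS,ca}}(\mathcal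 N,P_S)=C^{\mathrm{NS,nc}}(\mathcal N,P_S)=C^{\mathrm{NS,ca}}(\mathcal N^{\mathrm{CSIR}},P_S)=C^{\mathrm{NS,nc}}(\mathcal N^{\mathrm{CSIR}},P_S).$$ -/

import Mathlib

open Filter Topology

namespace NSCoding

noncomputable section

/-- A channel with state: a law `P_S` on the finite state alphabet `S` and, for every input `x` and
state `s`, a law `N(· | x, s)` on the finite output alphabet `Y`. -/
structure StateChannel (X Y S : Type*) [Fintype Y] [Fintype S] where
  /-- `stateLaw s` is `P_S(s)`. -/
  stateLaw : S → ℝ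
  /-- `kernel x s y` is `N(y | x, s)`. -/
  kernel : X → S → Y → ℝ
  stateLaw_mem : stateLaw ∈ stdSimplex ℝ S
  kernel_mem : ∀ x s, kernel x s ∈ stdSimplex ℝ Y

section Information

variable {X Y S : Type*} [Fintype X] [Fintype Y] [Fintype S]

/-- The conditional mutual information `I(X;Y|S)`, in bits, of a joint probability mass function
`p x y s`. Terms with `p x y s = 0` contribute `0`. -/
def condMutualInfo (p : X → Y → S → ℝ) : ℝ :=
  ∑ x, ∑ y, ∑ s, p x y s *
    Real.logb 2 ((p x y s * ∑ x', ∑ y', p x' y' s) / ((∑ y', p x y' s) * ∑ x', p x' y s))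

/-- The joint law `P_S(s) Q(x | s) N(y | x, s)` of input, output and state. -/
def StateChannel.jointLaw (W : StateChannel X Y S) (Q : S → X → ℝ) : X → Y → S → ℝ :=
  fun x y s => W.stateLaw s * Q s x * W.kernel x s y

/-- The set of all values `I(X;Y|S)`, over all conditional laws `P_{X|S}`. -/
def StateChannel.infoValues (W : StateChannel X Y S) : Set ℝ :=
  {v | ∃ Q : S → X → ℝ, (∀ s, Q s ∈ stdSimplex ℝ X) ∧ v = condMutualInfo (W.jointLaw Q)}

open Classical in
/-- The channel with state information at the receiver: the receiver sees `(y, s)`. -/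
def StateChannel.withCSIR (W : StateChannel X Y S) : StateChannel X (Y × S) S where
  stateLaw := W.stateLaw
  kernel := fun x s z => W.kernel x s z.1 * if z.2 = s then 1 else 0
  stateLaw_mem := W.stateLaw_mem
  kernel_mem := by
    intro x s
    refine ⟨fun z => mul_nonneg ((W.kernel_mem x s).1 z.1) (by split_ifs <;> norm_num), ?_⟩
    rw [Fintype.sum_prod_type]
    simpa using (W.kernel_mem x s).2

end Information

/-- A non-signaling-assisted coding scheme with message set `Fin M` and blocklength `n`:
`box w s y (x, w')` is the probability of outputs `x` (transmitter) and `w'` (receiver) given the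
inputs `(w, s)` (transmitter) and `y` (receiver). No causality is imposed here. -/
structure NSScheme (X Y S : Type*) [Fintype X] (M n : ℕ) where
  box : Fin M → (Fin n → S) → (Fin n → Y) → (Fin n → X) × Fin M → ℝ
  box_mem : ∀ w s y, box w s y ∈ stdSimplex ℝ ((Fin n → X) × Fin M)
  /-- The marginal of the transmitter's output does not depend on the receiver's input. -/
  noSignal_to_transmitter : ∀ w s y y' x,
    ∑ w', box w s y (x, w') = ∑ w', box w s y' (x, w')
  /-- The marginal of the receiver's output does not depend on the transmitter's input. -/
  noSignal_to_receiver : ∀ w₁ w₂ s₁ s₂ y w',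
    ∑ x, box w₁ s₁ y (x, w') = ∑ x, box w₂ s₂ y (x, w')

namespace NSScheme

variable {X Y S : Type*} [Fintype X] [Fintype Y] [Fintype S] {M n : ℕ}

open Classical in
/-- The marginal probability of the first `i` transmitter outputs agreeing with those of `x`,
jointly with the receiver output `w'`. -/
def prefixMarginal (Z : NSScheme X Y S M n) (i : ℕ) (x : Fin n → X) (w' w : Fin M)
    (s : Fin n → S) (y : Fin n → Y) : ℝ :=
  ∑ x' : Fin n → X with ∀ j : Fin n, (j : ℕ) < i → x' j = x j, Z.box w s y (x', w')

/-- Causal state information at the transmitter: for `1 ≤ i ≤ n - 1`, the joint law of the first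
`i` channel inputs and the decoded message does not depend on the states after time `i`. -/
def IsCausal (Z : NSScheme X Y S M n) : Prop :=
  ∀ i : ℕ, 1 ≤ i → i < n → ∀ (x : Fin n → X) (w' w : Fin M) (s s' : Fin n → S) (y : Fin n → Y),
    (∀ j : Fin n, (j : ℕ) < i → s j = s' j) →
      Z.prefixMarginal i x w' w s y = Z.prefixMarginal i x w' w s' y

/-- The probability of successful decoding of a uniformly distributed message over `n` memoryless
uses of the channel with i.i.d. states. -/
def successProb (Z : NSScheme X Y S M n) (W : StateChannel X Y S) : ℝ :=
  1 / (M : ℝ) * ∑ w : Fin M, ∑ x : Fin n → X, ∑ s : Fin n → S, ∑ y : Fin n → Y,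
    (∏ i, W.stateLaw (s i)) * (∏ i, W.kernel (x i) (s i) (y i)) * Z.box w s y (x, w)

end NSScheme

/-- The way in which the channel states are known to the transmitter. -/
inductive CSIT where
  | causal
  | noncausal

section Capacity

variable {X Y S : Type*} [Fintype X] [Fintype Y] [Fintype S]

/-- Schemes allowed under the given kind of state information at the transmitter. -/
def NSScheme.Allowed {M n : ℕ} (Z : NSScheme X Y S M n) : CSIT → Prop
  | .causal => Z.IsCausal
  | .noncausal => True

/-- `R ≥ 0` is achievable: there is a sequence of allowed schemes, of blocklength `n = 1, 2, …` and
with `M n ≥ 1` messages, with success probability tending to `1` and with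
`lim (log₂ M n) / n ≥ R` (the limit exists, in the extended reals). The term `n = 0` of the
sequence is irrelevant. -/
def StateChannel.IsAchievable (W : StateChannel X Y S) (c : CSIT) (R : ℝ) : Prop :=
  0 ≤ R ∧ ∃ (M : ℕ → ℕ) (Z : ∀ n, NSScheme X Y S (M n) n),
    (∀ n, 0 < M n) ∧ (∀ n, (Z n).Allowed c) ∧
    Tendsto (fun n => (Z n).successProb W) atTop (𝓝 1) ∧
    ∃ L : EReal, Tendsto (fun n : ℕ => ((Real.logb 2 (M n) / n : ℝ) : EReal)) atTop (𝓝 L) ∧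
      (R : EReal) ≤ L

/-- `C` is the non-signaling-assisted capacity: the supremum of the achievable rates. -/
def StateChannel.IsNSCapacity (W : StateChannel X Y S) (c : CSIT) (C : ℝ) : Prop :=
  IsLUB {R : ℝ | W.IsAchievable c R} C

end Capacity

end

end NSCoding

/-!
The proof compares everything with the largest value `C` of `I(X;Y|S)`. Since
`I(X;Y|S) = ∑ s, P_S(s) I(Q(· | s); N(· | ·, s))`, it is found by choosing a capacity-achieving
input law separately for every state, and giving the state to the receiver does not change it
(`infoValues_withCSIR`). So it suffices to show, for an arbitrary channel with state, that rates
above `C` are not achievable even with non-causal CSIT, and that rates below `C` are achievable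
with causal CSIT; the theorem applies this to `W` and to `W.withCSIR`.

*Converse.* Average a scheme over the message. The receiver's output is independent of the
transmitter's input, so the joint weight `hitProb` of a channel input and correct decoding has total
mass `1 / M` for all states and channel outputs; it is dominated by the law `inputProb` of the
channel input, which does not depend on the channel outputs. It is therefore a test that
distinguishes the channel (with power `η`) from a channel whose output is independent of the input
(with error `1 / M`), and the relative entropy of the two is at least `η log M - 1`. Take for the
second channel the product of the optimal output laws. By the Kuhn–Tucker conditions
(`exists_isMaxOn_mutualInfo`) every input letter has divergence at most the optimal mutual
information from the optimal output law, so the relative entropy is at most `n C`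
(`NSScheme.successProb_mul_log_le`).

*Achievability.* Conversely, let the channel inputs be drawn from `∏ Q(x_i | s_i)`, and consider any
weights below this law which have total mass `1 / M` for all states and channel outputs. They
define a non-signaling scheme (`causalScheme`), in which they are the weights of correct decoding;
the scheme is causal if the weights are built up letter by letter. Let `hitWeight` follow the posterior
law of the inputs given the channel outputs, from the mass `1 / M` on, as long as it stays below the
input law. Once it attains the input law on a sequence, conservation of mass forces it to remain
there. Hence decoding is correct on all sequences for which the ratio of posterior and prior exceeds
`M` (`hitWeight_eq_or_le`). The logarithm of this ratio is a sum of independent terms with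
mean `I(X;Y|S)`, so by Chernoff's bound the other sequences have exponentially small probability
if the rate is below `I(X;Y|S)`.
-/

open Filter Topology

namespace NSCoding

/-! ### Divergence and mutual information of a finite channel -/

section SingleLetter

variable {X Y S : Type*} [Fintype X] [Fintype Y] [Fintype S]

/-- The relative entropy, in nats, of two mass functions on a finite type. Its value is the usual
one only if `b` is positive wherever `a` is. -/
noncomputable def divergence (a b : Y → ℝ) : ℝ := ∑ y, a y * Real.log (a y / b y)

/-- The output law of the channel `K` under the input law `Q`. -/
def outputLaw (K : X → Y → ℝ) (Q : X → ℝ) (y : Y) : ℝ := ∑ x, Q x * K x y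

/-- The mutual information, in nats, between input and output of the channel `K` under the input
law `Q`. -/
noncomputable def mutualInfo (K : X → Y → ℝ) (Q : X → ℝ) : ℝ :=
  ∑ x, Q x * divergence (K x) (outputLaw K Q)

/-- The tangent line inequality for the logarithm. For `c = 1` it is the termwise form of Gibbs'
inequality, and other values of `c` are suited to mass functions with `a` close to `c * b`. -/
lemma le_mul_log_div {a b c : ℝ} (ha : 0 ≤ a) (hb : 0 ≤ b) (hab : 0 < a → 0 < b) (hc : 0 < c) :
    a * Real.log c + a - c * b ≤ a * Real.log (a / b) := by
  rcases ha.eq_or_lt with rfl | ha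
  · simpa using mul_nonneg hc.le hb
  have hb := hab ha
  have h := Real.one_sub_inv_le_log_of_pos (show 0 < a / b / c by positivity)
  rw [Real.log_div (by positivity) hc.ne'] at h
  have h' := mul_le_mul_of_nonneg_left h ha.le
  have e : a * (1 - (a / b / c)⁻¹) = a - c * b := by field_simp
  rw [e] at h'
  linarith

lemma divergence_nonneg {a b : Y → ℝ} (ha : a ∈ stdSimplex ℝ Y) (hb : b ∈ stdSimplex ℝ Y)
    (hab : ∀ y, 0 < a y → 0 < b y) : 0 ≤ divergence a b := by
  have h := Finset.sum_le_sum fun y (_ : y ∈ Finset.univ) =>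
    le_mul_log_div (ha.1 y) (hb.1 y) (hab y) one_pos
  simpa [Finset.sum_add_distrib, ha.2, hb.2, divergence] using h

lemma outputLaw_mem {K : X → Y → ℝ} (hK : ∀ x, K x ∈ stdSimplex ℝ Y) {Q : X → ℝ}
    (hQ : Q ∈ stdSimplex ℝ X) : outputLaw K Q ∈ stdSimplex ℝ Y := by
  refine ⟨fun y => Finset.sum_nonneg fun x _ => mul_nonneg (hQ.1 x) ((hK x).1 y), ?_⟩
  simp only [outputLaw]
  rw [Finset.sum_comm]
  simp [← Finset.mul_sum, (hK _).2, hQ.2]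

lemma outputLaw_pos {X Y : Type*} [Fintype X] {K : X → Y → ℝ} (hK : ∀ x y, 0 ≤ K x y)
    {Q : X → ℝ} (hQ : ∀ x, 0 ≤ Q x) {x : X} {y : Y} (h : Q x * K x y ≠ 0) : 0 < outputLaw K Q y :=
  Finset.sum_pos' (fun x _ => mul_nonneg (hQ x) (hK x y))
    ⟨x, Finset.mem_univ x, lt_of_le_of_ne (mul_nonneg (hQ x) (hK x y)) h.symm⟩

/-- The compensation identity: replacing the true output law by `V` costs the divergence between
them. -/
lemma sum_mul_divergence {K : X → Y → ℝ} (hK : ∀ x y, 0 ≤ K x y) {Q : X → ℝ}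
    (hQ : ∀ x, 0 ≤ Q x) {V : Y → ℝ} (hV : ∀ y, 0 < outputLaw K Q y → 0 < V y) :
    ∑ x, Q x * divergence (K x) V = mutualInfo K Q + divergence (outputLaw K Q) V := by
  have h : ∀ x y, Q x * K x y * Real.log (K x y / V y) =
      Q x * K x y * Real.log (K x y / outputLaw K Q y) +
        Q x * K x y * Real.log (outputLaw K Q y / V y) := by
    intro x y
    by_cases h0 : Q x * K x y = 0
    · simp [h0]
    have h1 := outputLaw_pos hK hQ h0
    have h2 := hV y h1
    have h3 := right_ne_zero_of_mul h0
    rw [Real.log_div h3 h2.ne', Real.log_div h3 h1.ne', Real.log_div h1.ne' h2.ne']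
    ring
  calc ∑ x, Q x * divergence (K x) V
      = ∑ x, ∑ y, Q x * K x y * Real.log (K x y / V y) := by
        simp only [divergence, Finset.mul_sum, mul_assoc]
    _ = mutualInfo K Q + ∑ x, ∑ y, Q x * K x y * Real.log (outputLaw K Q y / V y) := by
        simp only [h, Finset.sum_add_distrib, mutualInfo, divergence, Finset.mul_sum, mul_assoc]
    _ = _ := by
        rw [Finset.sum_comm]
        simp only [← Finset.sum_mul, divergence]
        rfl

lemma mutualInfo_eq_entropy_sub {K : X → Y → ℝ} (hK : ∀ x y, 0 ≤ K x y) {Q : X → ℝ}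
    (hQ : ∀ x, 0 ≤ Q x) :
    mutualInfo K Q = ∑ y, Real.negMulLog (outputLaw K Q y) -
      ∑ x, Q x * ∑ y, Real.negMulLog (K x y) := by
  -- the compensation identity for the constant function `1`
  have h := sum_mul_divergence hK hQ (V := fun _ => 1) (fun _ _ => one_pos)
  simp only [divergence, div_one] at h
  simp only [Real.negMulLog, neg_mul, Finset.sum_neg_distrib, mul_neg]
  linarith

/-- A capacity-achieving input law of a finite channel exists, and it satisfies the
Kuhn–Tucker conditions: no input letter has divergence from the optimal output law larger than the
capacity. -/
theorem exists_isMaxOn_mutualInfo [Nonempty X] {K : X → Y → ℝ}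
    (hK : ∀ x, K x ∈ stdSimplex ℝ Y) :
    ∃ Q ∈ stdSimplex ℝ X, (∀ Q' ∈ stdSimplex ℝ X, mutualInfo K Q' ≤ mutualInfo K Q) ∧
      ∀ x, (∀ y, 0 < K x y → 0 < outputLaw K Q y) ∧
        divergence (K x) (outputLaw K Q) ≤ mutualInfo K Q := by
  classical
  have hK0 : ∀ x y, 0 ≤ K x y := fun x => (hK x).1
  have hcont : ContinuousOn (mutualInfo K) (stdSimplex ℝ X) := by
    have : Continuous fun Q : X → ℝ => ∑ y, Real.negMulLog (outputLaw K Q y) -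
        ∑ x, Q x * ∑ y, Real.negMulLog (K x y) := by
      unfold outputLaw
      fun_prop
    exact this.continuousOn.congr fun Q hQ => mutualInfo_eq_entropy_sub hK0 hQ.1
  obtain ⟨Q, hQ, hmax⟩ := (isCompact_stdSimplex ℝ X).exists_isMaxOn
    ⟨_, single_mem_stdSimplex ℝ (Classical.arbitrary X)⟩ hcont
  have hmax : ∀ Q' ∈ stdSimplex ℝ X, mutualInfo K Q' ≤ mutualInfo K Q := fun Q' h => hmax h
  refine ⟨Q, hQ, hmax, fun x => ?_⟩
  set V := outputLaw K Q
  have hV : V ∈ stdSimplex ℝ Y := outputLaw_mem hK hQ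
  let U : ℝ → Y → ℝ := fun t y => (1 - t) * V y + t * K x y
  have hUlim : ∀ y, Tendsto (fun t => U t y) (𝓝[>] 0) (𝓝 (V y)) := by
    intro y
    have : Continuous fun t => U t y := by fun_prop
    simpa [U] using (this.tendsto 0).mono_left nhdsWithin_le_nhds
  have hIoo : ∀ᶠ t : ℝ in 𝓝[>] 0, t ∈ Set.Ioo (0 : ℝ) 1 := Ioo_mem_nhdsGT one_pos
  -- moving a little mass to `x` does not increase the mutual information
  have key : ∀ t ∈ Set.Ioo (0 : ℝ) 1, divergence (K x) (U t) ≤ mutualInfo K Q := by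
    rintro t ⟨ht0, ht1⟩
    set Q' : X → ℝ := (1 - t) • Q + t • Pi.single x 1 with hQ'
    have hQ'm : Q' ∈ stdSimplex ℝ X :=
      convex_stdSimplex ℝ X hQ (single_mem_stdSimplex ℝ x) (by linarith) ht0.le (by ring)
    have hout : outputLaw K Q' = U t := by
      funext y
      simp [outputLaw, hQ', U, V, add_mul, Finset.sum_add_distrib, mul_assoc, Finset.mul_sum,
        Pi.single_apply]
    have hUm : U t ∈ stdSimplex ℝ Y := hout ▸ outputLaw_mem hK hQ'm
    have hVU : ∀ y, 0 < V y → 0 < U t y := fun y hy =>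
      add_pos_of_pos_of_nonneg (mul_pos (by linarith) hy) (mul_nonneg ht0.le (hK0 x y))
    have h1 := sum_mul_divergence hK0 hQ.1 (V := U t) hVU
    have h2 := divergence_nonneg hV hUm hVU
    have h3 : mutualInfo K Q' =
        (1 - t) * ∑ x', Q x' * divergence (K x') (U t) + t * divergence (K x) (U t) := by
      rw [mutualInfo, hout]
      simp [hQ', add_mul, Finset.sum_add_distrib, mul_assoc, Finset.mul_sum, Pi.single_apply]
    have h4 := hmax Q' hQ'm
    rw [h3, h1] at h4
    have h5 : (1 - t) * mutualInfo K Q ≤ (1 - t) * (mutualInfo K Q + divergence V (U t)) :=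
      mul_le_mul_of_nonneg_left (by linarith) (by linarith)
    refine le_of_mul_le_mul_left ?_ ht0
    linarith
  have hsupp : ∀ y, 0 < K x y → 0 < V y := by
    intro y hy
    -- a bound on `-log (U t y)` which is uniform in `t`
    have hlow : ∀ t ∈ Set.Ioo (0 : ℝ) 1,
        K x y * Real.exp (-((mutualInfo K Q + 1) / K x y)) ≤ U t y := by
      rintro t ht
      have hU1 : ∀ z, 0 < K x z → 0 < U t z := fun z hz =>
        add_pos_of_nonneg_of_pos (mul_nonneg (by linarith [ht.2]) (hV.1 z)) (mul_pos ht.1 hz)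
      have hU0 : ∀ z, 0 ≤ U t z := fun z =>
        add_nonneg (mul_nonneg (by linarith [ht.2]) (hV.1 z)) (mul_nonneg ht.1.le (hK0 x z))
      have hUs : ∑ z, U t z = 1 := by
        simp [U, Finset.sum_add_distrib, ← Finset.mul_sum, hV.2, (hK x).2]
      have h1 : ∑ z ∈ Finset.univ.erase y, (K x z - U t z) ≤
          ∑ z ∈ Finset.univ.erase y, K x z * Real.log (K x z / U t z) :=
        Finset.sum_le_sum fun z _ => by
          simpa using le_mul_log_div (hK0 x z) (hU0 z) (hU1 z) one_pos
      have h2 : K x y * Real.log (K x y / U t y) ≤ mutualInfo K Q + 1 := by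
        have e1 := Finset.add_sum_erase Finset.univ
          (fun z => K x z * Real.log (K x z / U t z)) (Finset.mem_univ y)
        have e2 := Finset.add_sum_erase Finset.univ
          (fun z => K x z - U t z) (Finset.mem_univ y)
        have e3 : ∑ z, (K x z - U t z) = 0 := by
          rw [Finset.sum_sub_distrib, hUs, (hK x).2, sub_self]
        have e4 := key t ht
        have e5 : K x y ≤ 1 := by
          rw [← (hK x).2]
          exact Finset.single_le_sum (fun z _ => hK0 x z) (Finset.mem_univ y)
        simp only [divergence] at e4
        linarith [hU0 y]
      have h3 : Real.log (K x y / U t y) ≤ (mutualInfo K Q + 1) / K x y := by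
        rw [le_div_iff₀ hy]; linarith
      rw [Real.log_le_iff_le_exp (div_pos hy (hU1 y hy)), div_le_iff₀ (hU1 y hy)] at h3
      rw [Real.exp_neg, ← div_eq_mul_inv, div_le_iff₀ (Real.exp_pos _)]
      linarith
    exact lt_of_lt_of_le (by positivity)
      (ge_of_tendsto (hUlim y) (hIoo.mono fun t ht => hlow t ht))
  refine ⟨hsupp, ?_⟩
  refine le_of_tendsto (f := fun t => divergence (K x) (U t)) ?_ (hIoo.mono fun t ht => key t ht)
  refine tendsto_finsetSum _ fun y _ => ?_
  rcases (hK0 x y).eq_or_lt with h0 | h0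
  · simp [← h0]
  · have hVy := (hsupp y h0).ne'
    exact ((tendsto_const_nhds.div (hUlim y) hVy).log (div_ne_zero h0.ne' hVy)).const_mul _

/-- Conditioning on the state splits the information into that of the channels `N(· | ·, s)`; the
factor `Real.log 2` converts nats to bits. -/
lemma condMutualInfo_jointLaw (W : StateChannel X Y S) {Q : S → X → ℝ}
    (hQ : ∀ s, Q s ∈ stdSimplex ℝ X) :
    condMutualInfo (W.jointLaw Q) =
      (∑ s, W.stateLaw s * mutualInfo (fun x => W.kernel x s) (Q s)) / Real.log 2 := by
  have h1 : ∀ x s, ∑ y, W.jointLaw Q x y s = W.stateLaw s * Q s x := fun x s => by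
    simp [StateChannel.jointLaw, ← Finset.mul_sum, (W.kernel_mem x s).2]
  have h2 : ∀ s, ∑ x, W.stateLaw s * Q s x = W.stateLaw s := fun s => by
    simp [← Finset.mul_sum, (hQ s).2]
  have h3 : ∀ y s, ∑ x, W.jointLaw Q x y s =
      W.stateLaw s * outputLaw (fun x => W.kernel x s) (Q s) y := fun y s => by
    simp [StateChannel.jointLaw, outputLaw, Finset.mul_sum, mul_assoc]
  have h4 : ∀ x y s, W.jointLaw Q x y s * Real.logb 2 ((W.jointLaw Q x y s * W.stateLaw s) /
      ((W.stateLaw s * Q s x) * (W.stateLaw s * outputLaw (fun x => W.kernel x s) (Q s) y))) =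
      W.stateLaw s * (Q s x * (W.kernel x s y *
        Real.log (W.kernel x s y / outputLaw (fun x => W.kernel x s) (Q s) y))) /
        Real.log 2 := by
    intro x y s
    by_cases h0 : W.jointLaw Q x y s = 0
    · have : W.stateLaw s * (Q s x * W.kernel x s y) = 0 := by
        rw [← mul_assoc]; exact h0
      rw [h0, ← mul_assoc (Q s x), ← mul_assoc (W.stateLaw s), this]; simp
    have h0' : W.stateLaw s * Q s x * W.kernel x s y ≠ 0 := h0
    have hP := left_ne_zero_of_mul (left_ne_zero_of_mul h0')
    have hq := right_ne_zero_of_mul (left_ne_zero_of_mul h0')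
    have : W.jointLaw Q x y s * W.stateLaw s /
      ((W.stateLaw s * Q s x) * (W.stateLaw s * outputLaw (fun x => W.kernel x s) (Q s) y)) =
      W.kernel x s y / outputLaw (fun x => W.kernel x s) (Q s) y := by
      simp only [StateChannel.jointLaw]
      rw [show W.stateLaw s * Q s x * W.kernel x s y * W.stateLaw s =
        (W.stateLaw s * Q s x * W.stateLaw s) * W.kernel x s y by ring,
        ← mul_assoc (W.stateLaw s * Q s x), mul_div_mul_left _ _ (by positivity)]
    rw [this, Real.logb, StateChannel.jointLaw]
    ring
  simp only [condMutualInfo, h1, h2, h3, h4]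
  simp only [mutualInfo, divergence, Finset.mul_sum, Finset.sum_div]
  calc _ = ∑ x, ∑ s, ∑ y, _ := Finset.sum_congr rfl fun x _ => Finset.sum_comm
    _ = _ := Finset.sum_comm

lemma infoValues_withCSIR (W : StateChannel X Y S) : W.withCSIR.infoValues = W.infoValues := by
  classical
  have h : ∀ Q : S → X → ℝ, (∀ s, Q s ∈ stdSimplex ℝ X) →
      condMutualInfo (W.withCSIR.jointLaw Q) = condMutualInfo (W.jointLaw Q) := by
    intro Q hQ
    rw [condMutualInfo_jointLaw _ hQ, condMutualInfo_jointLaw _ hQ]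
    congr 1
    refine Finset.sum_congr rfl fun s _ => ?_
    congr 1
    simp only [mutualInfo, divergence, outputLaw, Fintype.sum_prod_type, StateChannel.withCSIR]
    refine Finset.sum_congr rfl fun x _ => ?_
    congr 1
    refine Finset.sum_congr rfl fun y _ => ?_
    rw [Finset.sum_eq_single s (fun s' _ hs' => by simp [hs']) (by simp)]
    simp
  ext v
  simp only [StateChannel.infoValues, Set.mem_ofPred_eq]
  exact exists_congr fun Q => and_congr_right fun hQ => by rw [h Q hQ]

end SingleLetter

/-! ### Sums over product distributions -/

section Product

variable {X Y S : Type*} [Fintype X] [Fintype Y] [Fintype S] {n : ℕ}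

lemma sum_prod_eq_one {f : Fin n → Y → ℝ} (hf : ∀ i, f i ∈ stdSimplex ℝ Y) :
    ∑ y : Fin n → Y, ∏ i, f i (y i) = 1 := by
  rw [← Fintype.prod_sum]
  exact Finset.prod_eq_one fun i _ => (hf i).2

/-- The expectation of a function of one coordinate of a vector with independent coordinates. -/
lemma sum_prod_mul_apply {f : Fin n → Y → ℝ} (hf : ∀ i, f i ∈ stdSimplex ℝ Y) (i : Fin n)
    (g : Y → ℝ) : ∑ y : Fin n → Y, (∏ j, f j (y j)) * g (y i) = ∑ b, f i b * g b := by
  have h : ∀ y : Fin n → Y, (∏ j, f j (y j)) * g (y i) =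
      ∏ j, f j (y j) * (if j = i then g (y j) else 1) := fun y => by
    rw [Finset.prod_mul_distrib, Fintype.prod_ite_eq']
  simp only [h]
  rw [← Fintype.prod_sum (fun j b => f j b * if j = i then g b else 1), Fintype.prod_eq_single i]
  · simp
  · intro j hj
    simpa [hj] using (hf j).2

/-- Divergence is additive on product distributions. -/
lemma sum_prod_mul_log {a b : Fin n → Y → ℝ} (ha : ∀ i, a i ∈ stdSimplex ℝ Y)
    (hab : ∀ i y, 0 < a i y → 0 < b i y) :
    ∑ y : Fin n → Y, (∏ i, a i (y i)) * Real.log ((∏ i, a i (y i)) / ∏ i, b i (y i)) =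
      ∑ i, divergence (a i) (b i) := by
  have h : ∀ y : Fin n → Y,
      (∏ i, a i (y i)) * Real.log ((∏ i, a i (y i)) / ∏ i, b i (y i)) =
        ∑ i, (∏ j, a j (y j)) * Real.log (a i (y i) / b i (y i)) := by
    intro y
    by_cases h0 : ∏ i, a i (y i) = 0
    · simp [h0]
    have hne : ∀ i, a i (y i) ≠ 0 := fun i hi =>
      h0 (Finset.prod_eq_zero (Finset.mem_univ i) hi)
    rw [← Finset.prod_div_distrib, Real.log_prod, Finset.mul_sum]
    intro i _
    exact div_ne_zero (hne i) (hab i _ (lt_of_le_of_ne ((ha i).1 _) (hne i).symm)).ne'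
  simp only [h]
  rw [Finset.sum_comm]
  exact Finset.sum_congr rfl fun i _ =>
    sum_prod_mul_apply ha i fun c => Real.log (a i c / b i c)

lemma sum_sum_sum_prod (F : X → S → Y → ℝ) :
    ∑ x : Fin n → X, ∑ s : Fin n → S, ∑ y : Fin n → Y, ∏ i, F (x i) (s i) (y i) =
      (∑ x, ∑ s, ∑ y, F x s y) ^ n := by
  rw [Fintype.sum_pow]
  refine Finset.sum_congr rfl fun x _ => ?_
  rw [Fintype.prod_sum fun i c => ∑ y, F (x i) c y]
  exact Finset.sum_congr rfl fun s _ => (Fintype.prod_sum fun i c => F (x i) (s i) c).symm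

end Product

/-! ### Converse -/

section Converse

variable {X Y S : Type*} [Fintype X] {M n : ℕ}

/-- The probability that the transmitter outputs `x` and the receiver decodes correctly, for a
uniform message, given the states `s` and the channel outputs `y`. -/
noncomputable def NSScheme.hitProb (Z : NSScheme X Y S M n) (s : Fin n → S) (y : Fin n → Y)
    (x : Fin n → X) : ℝ := 1 / (M : ℝ) * ∑ w, Z.box w s y (x, w)

/-- The probability that the transmitter outputs `x`, for a uniform message, given the states `s`
and the channel outputs `y`. -/
noncomputable def NSScheme.inputProb (Z : NSScheme X Y S M n) (s : Fin n → S) (y : Fin n → Y)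
    (x : Fin n → X) : ℝ := 1 / (M : ℝ) * ∑ w, ∑ w', Z.box w s y (x, w')

lemma NSScheme.hitProb_nonneg (Z : NSScheme X Y S M n) (s : Fin n → S) (y : Fin n → Y)
    (x : Fin n → X) : 0 ≤ Z.hitProb s y x :=
  mul_nonneg (by positivity) (Finset.sum_nonneg fun w _ => (Z.box_mem w s y).1 _)

lemma NSScheme.hitProb_le (Z : NSScheme X Y S M n) (s : Fin n → S) (y : Fin n → Y)
    (x : Fin n → X) : Z.hitProb s y x ≤ Z.inputProb s y x :=
  mul_le_mul_of_nonneg_left (Finset.sum_le_sum fun w _ =>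
    Finset.single_le_sum (fun w' _ => (Z.box_mem w s y).1 (x, w')) (Finset.mem_univ w))
    (by positivity)

lemma NSScheme.inputProb_congr (Z : NSScheme X Y S M n) (s : Fin n → S) (y y' : Fin n → Y)
    (x : Fin n → X) : Z.inputProb s y x = Z.inputProb s y' x := by
  simp only [NSScheme.inputProb]
  exact congrArg _ (Finset.sum_congr rfl fun w _ => Z.noSignal_to_transmitter w s y y' x)

lemma NSScheme.sum_inputProb (Z : NSScheme X Y S M n) (hM : 0 < M) (s : Fin n → S)
    (y : Fin n → Y) : ∑ x, Z.inputProb s y x = 1 := by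
  have h : ∀ w, ∑ x, ∑ w', Z.box w s y (x, w') = 1 := fun w => by
    rw [← Fintype.sum_prod_type]; exact (Z.box_mem w s y).2
  simp only [NSScheme.inputProb, ← Finset.mul_sum]
  rw [Finset.sum_comm]
  simp only [h]
  have : (M : ℝ) ≠ 0 := by positivity
  simp [this]

/-- Since the receiver's output is independent of the message, it is correct with probability
`1 / M` whenever the channel output is independent of the channel input. -/
lemma NSScheme.sum_hitProb (Z : NSScheme X Y S M n) (hM : 0 < M) (s : Fin n → S)
    (y : Fin n → Y) : ∑ x, Z.hitProb s y x = 1 / M := by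
  have h : ∀ w, ∑ x, Z.box w s y (x, w) = ∑ x, Z.box ⟨0, hM⟩ s y (x, w) := fun w =>
    Z.noSignal_to_receiver _ _ _ _ _ _
  simp only [NSScheme.hitProb, ← Finset.mul_sum]
  rw [Finset.sum_comm]
  simp only [h]
  rw [Finset.sum_comm, ← Fintype.sum_prod_type, (Z.box_mem ⟨0, hM⟩ s y).2, mul_one]

variable [Fintype Y] [Fintype S]

lemma NSScheme.successProb_eq (Z : NSScheme X Y S M n) (W : StateChannel X Y S) :
    Z.successProb W = ∑ s : Fin n → S, (∏ i, W.stateLaw (s i)) * ∑ y : Fin n → Y, ∑ x : Fin n → X,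
      (∏ i, W.kernel (x i) (s i) (y i)) * Z.hitProb s y x := by
  simp only [NSScheme.successProb, NSScheme.hitProb, Finset.mul_sum]
  rw [Finset.sum_comm]
  simp only [Finset.sum_comm (s := (Finset.univ : Finset (Fin M)))]
  rw [Finset.sum_comm]
  refine Finset.sum_congr rfl fun s _ => ?_
  rw [Finset.sum_comm]
  refine Finset.sum_congr rfl fun y _ => Finset.sum_congr rfl fun x _ =>
    Finset.sum_congr rfl fun w _ => ?_
  ring

/-- The meta-converse at a fixed state sequence: compare the channel with the one whose output
is drawn from the product of the laws `V`, independently of the input. -/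
lemma NSScheme.sum_kernel_mul_hitProb_mul_log_le (Z : NSScheme X Y S M n) (W : StateChannel X Y S)
    (hM : 0 < M) {V : S → Y → ℝ} (hV : ∀ s, V s ∈ stdSimplex ℝ Y) {c : S → ℝ}
    (hsupp : ∀ x s y, 0 < W.kernel x s y → 0 < V s y)
    (hc : ∀ x s, divergence (W.kernel x s) (V s) ≤ c s) (s : Fin n → S) :
    (∑ y : Fin n → Y, ∑ x : Fin n → X, (∏ i, W.kernel (x i) (s i) (y i)) * Z.hitProb s y x) *
      Real.log M - 1 ≤ ∑ i, c (s i) := by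
  rcases isEmpty_or_nonempty (Fin n → Y) with hempty | ⟨⟨y₀⟩⟩
  · have h := sum_prod_eq_one (fun i => hV (s i))
    rw [Finset.univ_eq_empty (α := Fin n → Y), Finset.sum_empty] at h
    exact absurd h (by norm_num)
  have hM' : (0 : ℝ) < M := by exact_mod_cast hM
  set A : (Fin n → X) → (Fin n → Y) → ℝ := fun x y => ∏ i, W.kernel (x i) (s i) (y i) with hA
  set B : (Fin n → Y) → ℝ := fun y => ∏ i, V (s i) (y i) with hB
  have hA0 : ∀ x y, 0 ≤ A x y := fun x y =>
    Finset.prod_nonneg fun i _ => (W.kernel_mem _ _).1 _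
  have hB0 : ∀ y, 0 ≤ B y := fun y => Finset.prod_nonneg fun i _ => (hV _).1 _
  have hAB : ∀ x y, 0 < A x y → 0 < B y := fun x y h =>
    Finset.prod_pos fun i _ => hsupp (x i) _ _ (lt_of_le_of_ne ((W.kernel_mem _ _).1 _)
      fun h0 => h.ne' (Finset.prod_eq_zero (Finset.mem_univ i) h0.symm))
  have hA1 : ∀ x, ∑ y, A x y = 1 := fun x => sum_prod_eq_one fun i => W.kernel_mem (x i) (s i)
  have hB1 : ∑ y, B y = 1 := sum_prod_eq_one fun i => hV (s i)
  have hin : ∀ y x, Z.inputProb s y x = Z.inputProb s y₀ x := fun y x => Z.inputProb_congr s y y₀ x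
  -- use the tangent of the logarithm at `M` on correct decoding, and at `1` on its complement
  have hpt : ∀ x y, A x y * Z.hitProb s y x * Real.log M + A x y * Z.inputProb s y₀ x -
      Z.inputProb s y₀ x * B y - M * (Z.hitProb s y x * B y) ≤
      Z.inputProb s y₀ x * (A x y * Real.log (A x y / B y)) := by
    intro x y
    have h1 := mul_le_mul_of_nonneg_left
      (le_mul_log_div (hA0 x y) (hB0 y) (hAB x y) hM') (Z.hitProb_nonneg s y x)
    have h2 := mul_le_mul_of_nonneg_left
      (le_mul_log_div (hA0 x y) (hB0 y) (hAB x y) one_pos)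
      (sub_nonneg.2 ((Z.hitProb_le s y x).trans_eq (hin y x)))
    have h3 := mul_nonneg (Z.hitProb_nonneg s y x) (hB0 y)
    simp only [Real.log_one] at h2
    linarith
  have hsum := Finset.sum_le_sum fun y (_ : y ∈ Finset.univ) =>
    Finset.sum_le_sum fun x (_ : x ∈ Finset.univ) => hpt x y
  have hp1 : ∑ x, Z.inputProb s y₀ x = 1 := Z.sum_inputProb hM s y₀
  have e1 : ∑ y, ∑ x, A x y * Z.inputProb s y₀ x = 1 := by
    rw [Finset.sum_comm]
    simp only [← Finset.sum_mul, hA1, one_mul, hp1]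
  have e2 : ∑ y, ∑ x, Z.inputProb s y₀ x * B y = 1 := by
    simp only [← Finset.sum_mul, hp1, one_mul, hB1]
  have e3 : ∑ y, ∑ x, M * (Z.hitProb s y x * B y) = 1 := by
    simp only [← Finset.mul_sum, ← Finset.sum_mul, Z.sum_hitProb hM, hB1]
    field_simp
  have e4 : ∑ y, ∑ x, Z.inputProb s y₀ x * (A x y * Real.log (A x y / B y)) ≤ ∑ i, c (s i) := by
    rw [Finset.sum_comm]
    simp only [← Finset.mul_sum]
    calc _ ≤ ∑ x, Z.inputProb s y₀ x * ∑ i, c (s i) := by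
          refine Finset.sum_le_sum fun x _ => mul_le_mul_of_nonneg_left ?_
            ((Z.hitProb_nonneg s y₀ x).trans (Z.hitProb_le s y₀ x))
          rw [hA, hB, sum_prod_mul_log (fun i => W.kernel_mem (x i) (s i))
            (fun i y => hsupp (x i) (s i) y)]
          exact Finset.sum_le_sum fun i _ => hc _ _
      _ = _ := by rw [← Finset.sum_mul, hp1, one_mul]
  simp only [Finset.sum_sub_distrib, Finset.sum_add_distrib, e1, e2, e3] at hsum
  simp only [Finset.sum_mul]
  linarith

lemma NSScheme.successProb_mul_log_le (Z : NSScheme X Y S M n) (W : StateChannel X Y S)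
    (hM : 0 < M) {V : S → Y → ℝ} (hV : ∀ s, V s ∈ stdSimplex ℝ Y) {c : S → ℝ}
    (hsupp : ∀ x s y, 0 < W.kernel x s y → 0 < V s y)
    (hc : ∀ x s, divergence (W.kernel x s) (V s) ≤ c s) :
    Z.successProb W * Real.log M - 1 ≤ n * ∑ s, W.stateLaw s * c s := by
  have hP := fun _ : Fin n => W.stateLaw_mem
  have h := Finset.sum_le_sum fun s (_ : s ∈ Finset.univ) => mul_le_mul_of_nonneg_left
    (Z.sum_kernel_mul_hitProb_mul_log_le W hM hV hsupp hc s)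
    (Finset.prod_nonneg fun (i : Fin n) (_ : i ∈ Finset.univ) => W.stateLaw_mem.1 (s i))
  have e : ∑ s : Fin n → S, (∏ i, W.stateLaw (s i)) * ∑ i, c (s i) =
      n * ∑ s, W.stateLaw s * c s := by
    simp only [Finset.mul_sum]
    rw [Finset.sum_comm]
    simp [sum_prod_mul_apply hP, Finset.mul_sum]
  simp only [mul_sub, mul_one, Finset.sum_sub_distrib, sum_prod_eq_one hP, ← mul_assoc,
    ← Finset.sum_mul] at h
  rw [e] at h
  rwa [Z.successProb_eq]

/-- The largest value `C` of `I(X;Y|S)` is attained by optimizing the input law for every state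
separately. A scheme of blocklength `n` that succeeds with probability `η` sends at most
`(n * C + O(1)) / η` bits. -/
theorem exists_isGreatest_infoValues [Nonempty X] (W : StateChannel X Y S) :
    ∃ C, IsGreatest W.infoValues C ∧
      ∀ (M n : ℕ) (Z : NSScheme X Y S M n), 0 < M →
        Z.successProb W * Real.logb 2 M ≤ n * C + 1 / Real.log 2 := by
  choose Q hQ hmax hKT using fun s => exists_isMaxOn_mutualInfo fun x => W.kernel_mem x s
  have hlog := Real.log_pos one_lt_two
  refine ⟨_, ⟨⟨Q, hQ, (condMutualInfo_jointLaw W hQ).symm⟩, ?_⟩, ?_⟩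
  · rintro _ ⟨Q', hQ', rfl⟩
    rw [condMutualInfo_jointLaw W hQ']
    gcongr with s
    · exact W.stateLaw_mem.1 s
    · exact hmax s _ (hQ' s)
  · intro M n Z hM
    have h := Z.successProb_mul_log_le W hM
      (fun s => outputLaw_mem (fun x => W.kernel_mem x s) (hQ s))
      (fun x s => (hKT s x).1) (fun x s => (hKT s x).2)
    rw [Real.logb, ← mul_div_assoc, ← mul_div_assoc, ← add_div]
    gcongr
    linarith

lemma StateChannel.IsAchievable.le {W : StateChannel X Y S} {c : CSIT} {R C : ℝ}
    (hR : W.IsAchievable c R)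
    (hC : ∀ (M n : ℕ) (Z : NSScheme X Y S M n), 0 < M →
        Z.successProb W * Real.logb 2 M ≤ n * C + 1 / Real.log 2) : R ≤ C := by
  obtain ⟨-, M, Z, hM, -, hη, L, hL, hRL⟩ := hR
  refine le_of_forall_lt fun b hb => ?_
  obtain ⟨b', hbb', hb'⟩ := exists_between hb
  refine hbb'.trans_le ?_
  have hev : ∀ᶠ n : ℕ in atTop, b' < Real.logb 2 (M n) / n := by
    have : (b' : EReal) < L := (EReal.coe_lt_coe_iff.2 hb').trans_le hRL
    exact (hL.eventually_const_lt this).mono fun n hn => EReal.coe_lt_coe_iff.1 hn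
  have h1 : Tendsto (fun n => (Z n).successProb W * b') atTop (𝓝 (1 * b')) := hη.mul_const b'
  have h2 : Tendsto (fun n : ℕ => C + 1 / Real.log 2 / n) atTop (𝓝 (C + 0)) :=
    (tendsto_const_div_atTop_nhds_zero_nat _).const_add C
  rw [one_mul] at h1
  rw [add_zero] at h2
  refine le_of_tendsto_of_tendsto h1 h2 ?_
  filter_upwards [hev, eventually_gt_atTop 0, hη.eventually_const_lt one_pos] with n hn hn0 hηn
  have hn0' : (0 : ℝ) < n := by exact_mod_cast hn0
  calc (Z n).successProb W * b' ≤ (Z n).successProb W * (Real.logb 2 (M n) / n) := by gcongr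
    _ = (Z n).successProb W * Real.logb 2 (M n) / n := by ring
    _ ≤ (n * C + 1 / Real.log 2) / n := by gcongr; exact hC _ _ (Z n) (hM n)
    _ = _ := by field_simp

end Converse

/-! ### Causal weights below the input law -/

section Weights

variable {X Y S : Type*} [Fintype X]

/-- Weights of total mass `g` between `a` and `b`, obtained by interpolating linearly. If
`∑ a = ∑ b`, the coefficient is the junk value `0`, and the weights are `a`. -/
noncomputable def fillUp (a b : X → ℝ) (g : ℝ) (x : X) : ℝ :=
  a x + (g - ∑ x', a x') / (∑ x', b x' - ∑ x', a x') * (b x - a x)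

lemma le_fillUp {a b : X → ℝ} {g : ℝ} (hab : ∀ x, a x ≤ b x) (ha : ∑ x, a x ≤ g)
    (hb : g ≤ ∑ x, b x) (x : X) : a x ≤ fillUp a b g x :=
  le_add_of_nonneg_right (mul_nonneg (div_nonneg (by linarith) (by linarith))
    (sub_nonneg.2 (hab x)))

lemma fillUp_le {a b : X → ℝ} {g : ℝ} (hab : ∀ x, a x ≤ b x) (ha : ∑ x, a x ≤ g)
    (hb : g ≤ ∑ x, b x) (x : X) : fillUp a b g x ≤ b x := by
  have h := mul_le_mul_of_nonneg_right
    (div_le_one_of_le₀ (sub_le_sub_right hb (∑ x', a x')) (by linarith)) (sub_nonneg.2 (hab x))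
  simp only [fillUp]
  linarith

lemma sum_fillUp {a b : X → ℝ} {g : ℝ} (ha : ∑ x, a x ≤ g) (hb : g ≤ ∑ x, b x) :
    ∑ x, fillUp a b g x = g := by
  simp only [fillUp, Finset.sum_add_distrib, ← Finset.mul_sum, Finset.sum_sub_distrib]
  rcases eq_or_ne (∑ x, b x - ∑ x, a x) 0 with h | h
  · rw [h]; linarith
  · rw [div_mul_cancel₀ _ h]; ring

/-- The probability of the input sequence `x` given the states `s`, when the inputs are drawn
independently from `Q`. -/
def inputWeight (Q : S → X → ℝ) {n : ℕ} (s : Fin n → S) (x : Fin n → X) : ℝ :=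
  ∏ i, Q (s i) (x i)

/-- The joint probability of the input sequence `x` and of correct decoding, given the states `s`
and the channel outputs `y`. It starts from the mass `m` for the empty sequence. In every step, the
mass of a sequence is distributed over its one-letter extensions, following `D` (the posterior law
of the input) as far as the input law `inputWeight` permits; the rest of the mass is placed
where there is still room below the input law. -/
noncomputable def hitWeight (Q : S → X → ℝ) (D : S → Y → X → ℝ) (m : ℝ) :
    ∀ n, (Fin n → S) → (Fin n → Y) → (Fin n → X) → ℝ
  | 0, _, _, _ => m
  | n + 1, s, y, x =>
    let g := hitWeight Q D m n (Fin.init s) (Fin.init y) (Fin.init x)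
    let b := fun a => inputWeight Q (Fin.init s) (Fin.init x) * Q (s (Fin.last n)) a
    fillUp (fun a => min (g * D (s (Fin.last n)) (y (Fin.last n)) a) (b a)) b g (x (Fin.last n))

lemma inputWeight_succ {X S : Type*} (Q : S → X → ℝ) {n : ℕ} (s : Fin (n + 1) → S)
    (x : Fin (n + 1) → X) : inputWeight Q s x =
      inputWeight Q (Fin.init s) (Fin.init x) * Q (s (Fin.last n)) (x (Fin.last n)) :=
  Fin.prod_univ_castSucc _

lemma sum_snoc {n : ℕ} (f : (Fin (n + 1) → X) → ℝ) :
    ∑ x, f x = ∑ x : Fin n → X, ∑ a, f (Fin.snoc x a) := by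
  rw [← (Fin.snocEquiv fun _ => X).sum_comp, Fintype.sum_prod_type, Finset.sum_comm]
  rfl

open Classical in
/-- If the weights of the one-letter extensions of a sequence sum to the weight of that sequence,
then the marginal weights of the first `i` letters do not depend on the states after time `i`. -/
lemma sum_prefix_congr {g : ∀ n, (Fin n → S) → (Fin n → Y) → (Fin n → X) → ℝ}
    (hg : ∀ n s y x, ∑ a, g (n + 1) s y (Fin.snoc x a) = g n (Fin.init s) (Fin.init y) x)
    {n : ℕ} (i : ℕ) (x : Fin n → X) {s s' : Fin n → S} (y : Fin n → Y)
    (hs : ∀ j : Fin n, (j : ℕ) < i → s j = s' j) :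
    ∑ x' : Fin n → X with ∀ j : Fin n, (j : ℕ) < i → x' j = x j, g n s y x' =
      ∑ x' : Fin n → X with ∀ j : Fin n, (j : ℕ) < i → x' j = x j, g n s' y x' := by
  induction n with
  | zero => rw [Subsingleton.elim s s']
  | succ n ih =>
    by_cases hi : n + 1 ≤ i
    · rw [funext fun j => hs j (by omega)]
    have hiff : ∀ (x' : Fin n → X) (a : X),
        (∀ j : Fin (n + 1), (j : ℕ) < i → (Fin.snoc x' a : Fin (n + 1) → X) j = x j) ↔
          ∀ j : Fin n, (j : ℕ) < i → x' j = Fin.init x j := by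
      intro x' a
      rw [Fin.forall_fin_succ']
      simp only [Fin.snoc_castSucc, Fin.val_castSucc, Fin.val_last, Fin.init_def]
      exact and_iff_left fun h => absurd h (by omega)
    have hstep : ∀ r : Fin (n + 1) → S,
        ∑ x' : Fin (n + 1) → X with ∀ j : Fin (n + 1), (j : ℕ) < i → x' j = x j,
          g (n + 1) r y x' =
        ∑ x' : Fin n → X with ∀ j : Fin n, (j : ℕ) < i → x' j = Fin.init x j,
          g n (Fin.init r) (Fin.init y) x' := by
      intro r
      rw [Finset.sum_filter, Finset.sum_filter, sum_snoc]
      refine Finset.sum_congr rfl fun x' _ => ?_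
      simp only [hiff]
      split_ifs
      · exact hg n r y x'
      · simp
    rw [hstep, hstep]
    exact ih (Fin.init x) (Fin.init y) fun j hj => hs j.castSucc hj

variable {Q : S → X → ℝ} {D : S → Y → X → ℝ} {m : ℝ} {n : ℕ}

lemma inputWeight_nonneg (hQ : ∀ s, Q s ∈ stdSimplex ℝ X) (s : Fin n → S) (x : Fin n → X) :
    0 ≤ inputWeight Q s x := Finset.prod_nonneg fun i _ => (hQ (s i)).1 (x i)

lemma sum_inputWeight (hQ : ∀ s, Q s ∈ stdSimplex ℝ X) (s : Fin n → S) :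
    ∑ x, inputWeight Q s x = 1 := sum_prod_eq_one fun i => hQ (s i)

lemma sum_inputWeight_snoc (hQ : ∀ s, Q s ∈ stdSimplex ℝ X) (s : Fin (n + 1) → S)
    (x : Fin n → X) : ∑ a, inputWeight Q s (Fin.snoc x a) = inputWeight Q (Fin.init s) x := by
  simp [inputWeight_succ, ← Finset.mul_sum, (hQ _).2]

lemma sum_inputWeight_mul (hQ : ∀ s, Q s ∈ stdSimplex ℝ X) (p : ℝ) (s : S) :
    ∑ a, p * Q s a = p := by
  rw [← Finset.mul_sum, (hQ s).2, mul_one]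

lemma sum_min_le (hD1 : ∀ s y, ∑ x, D s y x ≤ 1) {g : ℝ} (hg : 0 ≤ g) (b : X → ℝ) (s : S) (y : Y) :
    ∑ a, min (g * D s y a) (b a) ≤ g := by
  refine (Finset.sum_le_sum fun a _ => min_le_left _ _).trans ?_
  rw [← Finset.mul_sum]
  exact mul_le_of_le_one_right hg (hD1 s y)

lemma hitWeight_nonneg_and_le (hQ : ∀ s, Q s ∈ stdSimplex ℝ X) (hD0 : ∀ s y x, 0 ≤ D s y x)
    (hD1 : ∀ s y, ∑ x, D s y x ≤ 1) (hm0 : 0 ≤ m) (hm1 : m ≤ 1) (s : Fin n → S) (y : Fin n → Y)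
    (x : Fin n → X) :
    0 ≤ hitWeight Q D m n s y x ∧ hitWeight Q D m n s y x ≤ inputWeight Q s x := by
  induction n with
  | zero => simpa [hitWeight, inputWeight] using ⟨hm0, hm1⟩
  | succ n ih =>
    obtain ⟨h0, h1⟩ := ih (Fin.init s) (Fin.init y) (Fin.init x)
    have ha := sum_min_le hD1 h0
      (fun a => inputWeight Q (Fin.init s) (Fin.init x) * Q (s (Fin.last n)) a)
      (s (Fin.last n)) (y (Fin.last n))
    have hb := h1.trans_eq (sum_inputWeight_mul hQ _ (s (Fin.last n))).symm
    rw [inputWeight_succ, hitWeight]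
    refine ⟨le_trans ?_ (le_fillUp (fun a => min_le_right _ _) ha hb _),
      fillUp_le (fun a => min_le_right _ _) ha hb _⟩
    exact le_min (mul_nonneg h0 (hD0 _ _ _))
      (mul_nonneg (inputWeight_nonneg hQ _ _) ((hQ _).1 _))

lemma sum_hitWeight_snoc (hQ : ∀ s, Q s ∈ stdSimplex ℝ X) (hD0 : ∀ s y x, 0 ≤ D s y x)
    (hD1 : ∀ s y, ∑ x, D s y x ≤ 1) (hm0 : 0 ≤ m) (hm1 : m ≤ 1) (s : Fin (n + 1) → S)
    (y : Fin (n + 1) → Y) (x : Fin n → X) :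
    ∑ a, hitWeight Q D m (n + 1) s y (Fin.snoc x a) =
      hitWeight Q D m n (Fin.init s) (Fin.init y) x := by
  obtain ⟨h0, h1⟩ := hitWeight_nonneg_and_le hQ hD0 hD1 hm0 hm1 (Fin.init s) (Fin.init y) x
  simp only [hitWeight, Fin.init_snoc, Fin.snoc_last]
  exact sum_fillUp (sum_min_le hD1 h0 _ _ _) (h1.trans_eq (sum_inputWeight_mul hQ _ _).symm)

lemma sum_hitWeight (hQ : ∀ s, Q s ∈ stdSimplex ℝ X) (hD0 : ∀ s y x, 0 ≤ D s y x)
    (hD1 : ∀ s y, ∑ x, D s y x ≤ 1) (hm0 : 0 ≤ m) (hm1 : m ≤ 1) (s : Fin n → S)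
    (y : Fin n → Y) : ∑ x, hitWeight Q D m n s y x = m := by
  induction n with
  | zero => simp [hitWeight]
  | succ n ih =>
    rw [sum_snoc]
    simp only [sum_hitWeight_snoc hQ hD0 hD1 hm0 hm1, ih]

lemma hitWeight_one (hQ : ∀ s, Q s ∈ stdSimplex ℝ X) (hD0 : ∀ s y x, 0 ≤ D s y x)
    (hD1 : ∀ s y, ∑ x, D s y x ≤ 1) (s : Fin n → S) (y : Fin n → Y) (x : Fin n → X) :
    hitWeight Q D 1 n s y x = inputWeight Q s x := by
  refine (Finset.sum_eq_sum_iff_of_le fun x _ =>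
    (hitWeight_nonneg_and_le hQ hD0 hD1 zero_le_one le_rfl s y x).2).1 ?_ x (Finset.mem_univ x)
  rw [sum_hitWeight hQ hD0 hD1 zero_le_one le_rfl, sum_inputWeight hQ]

/-- Either the weight has been stopped at its upper bound, or it has followed `D` all the way. The
upper bound is absorbing: once it is attained there is no room to move mass. -/
lemma hitWeight_eq_or_le (hQ : ∀ s, Q s ∈ stdSimplex ℝ X) (hD0 : ∀ s y x, 0 ≤ D s y x)
    (hD1 : ∀ s y, ∑ x, D s y x ≤ 1) (hm0 : 0 ≤ m) (hm1 : m ≤ 1) (s : Fin n → S)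
    (y : Fin n → Y) (x : Fin n → X) :
    hitWeight Q D m n s y x = inputWeight Q s x ∨
      m * ∏ i, D (s i) (y i) (x i) ≤ hitWeight Q D m n s y x := by
  induction n with
  | zero => right; simp [hitWeight]
  | succ n ih =>
    obtain ⟨h0, h1⟩ := hitWeight_nonneg_and_le hQ hD0 hD1 hm0 hm1 (Fin.init s) (Fin.init y)
      (Fin.init x)
    have hle := (hitWeight_nonneg_and_le hQ hD0 hD1 hm0 hm1 s y x).2
    rcases ih (Fin.init s) (Fin.init y) (Fin.init x) with h | h
    · left
      have hx : (Fin.snoc (Fin.init x) (x (Fin.last n)) : Fin (n + 1) → X) = x :=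
        Fin.snoc_init_self x
      have hsum := (sum_hitWeight_snoc hQ hD0 hD1 hm0 hm1 s y (Fin.init x)).trans
        (h.trans (sum_inputWeight_snoc hQ s (Fin.init x)).symm)
      have := (Finset.sum_eq_sum_iff_of_le fun a _ =>
        (hitWeight_nonneg_and_le hQ hD0 hD1 hm0 hm1 s y (Fin.snoc (Fin.init x) a)).2).1 hsum
        (x (Fin.last n)) (Finset.mem_univ _)
      rwa [hx] at this
    · have hmin : min (hitWeight Q D m n (Fin.init s) (Fin.init y) (Fin.init x) *
          D (s (Fin.last n)) (y (Fin.last n)) (x (Fin.last n))) (inputWeight Q s x) ≤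
          hitWeight Q D m (n + 1) s y x := by
        rw [inputWeight_succ, hitWeight]
        exact le_fillUp (a := fun a => min (_ * D _ _ a) _) (fun a => min_le_right _ _)
          (sum_min_le hD1 h0 _ _ _) (h1.trans_eq (sum_inputWeight_mul hQ _ _).symm) _
      rcases min_le_iff.1 hmin with h' | h'
      · right
        rw [Fin.prod_univ_castSucc, ← mul_assoc]
        exact (mul_le_mul_of_nonneg_right h (hD0 _ _ _)).trans h'
      · exact Or.inl (hle.antisymm h')

end Weights

/-! ### Causal schemes -/

section Scheme

variable {X Y S : Type*} [Fintype X] {Q : S → X → ℝ} {D : S → Y → X → ℝ} {M n : ℕ}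

lemma sum_ite_eq_add {ι : Type*} [Fintype ι] [DecidableEq ι] (w : ι) (a b : ℝ) :
    ∑ w', (if w' = w then a else b) = a + (Fintype.card ι - 1) * b := by
  have h : ∀ w', (if w' = w then a else b) = (if w' = w then a - b else 0) + b := fun w' => by
    split_ifs <;> ring
  simp only [h, Finset.sum_add_distrib, Finset.sum_ite_eq', Finset.mem_univ, if_true,
    Finset.sum_const, Finset.card_univ, nsmul_eq_mul]
  ring

lemma hitWeight_add (hQ : ∀ s, Q s ∈ stdSimplex ℝ X) (hD0 : ∀ s y x, 0 ≤ D s y x)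
    (hD1 : ∀ s y, ∑ x, D s y x ≤ 1) (s : Fin n → S) (y : Fin n → Y) (x : Fin n → X) :
    hitWeight Q D (1 / M) n s y x +
      (M - 1) * ((inputWeight Q s x - hitWeight Q D (1 / M) n s y x) / (M - 1)) =
      inputWeight Q s x := by
  rcases eq_or_ne M 1 with rfl | h
  -- for a single message there are no wrong decisions, and the quotient is `0 / 0`
  · simp [hitWeight_one hQ hD0 hD1]
  · have : (M : ℝ) - 1 ≠ 0 := sub_ne_zero.2 (by exact_mod_cast h)
    rw [mul_div_cancel₀ _ this]
    ring

/-- The scheme whose channel input follows `Q`, with decoding correct according to `hitWeight`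
started from `1 / M`; the rest of the input law is shared equally among the wrong messages. -/
noncomputable def causalScheme (hQ : ∀ s, Q s ∈ stdSimplex ℝ X) (hD0 : ∀ s y x, 0 ≤ D s y x)
    (hD1 : ∀ s y, ∑ x, D s y x ≤ 1) (hM : 0 < M) (n : ℕ) : NSScheme X Y S M n where
  box w s y z := if z.2 = w then hitWeight Q D (1 / M) n s y z.1 else
    (inputWeight Q s z.1 - hitWeight Q D (1 / M) n s y z.1) / (M - 1)
  box_mem w s y := by
    have hM1 : (1 : ℝ) ≤ M := by exact_mod_cast hM
    refine ⟨fun z => ?_, ?_⟩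
    · obtain ⟨h0, h1⟩ := hitWeight_nonneg_and_le (m := 1 / (M : ℝ)) hQ hD0 hD1 (by positivity)
        (div_le_one_of_le₀ hM1 (by positivity)) s y z.1
      dsimp only
      split_ifs
      · exact h0
      · exact div_nonneg (sub_nonneg.2 h1) (sub_nonneg.2 hM1)
    · simp only [Fintype.sum_prod_type, sum_ite_eq_add, Fintype.card_fin,
        hitWeight_add hQ hD0 hD1, sum_inputWeight hQ]
  noSignal_to_transmitter w s y y' x := by
    simp only [sum_ite_eq_add, Fintype.card_fin, hitWeight_add hQ hD0 hD1]
  noSignal_to_receiver w₁ w₂ s₁ s₂ y w' := by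
    have hM1 : (1 : ℝ) ≤ M := by exact_mod_cast hM
    have h : ∀ w s, ∑ x, (if w' = w then hitWeight Q D (1 / M) n s y x else
        (inputWeight Q s x - hitWeight Q D (1 / M) n s y x) / (M - 1)) = 1 / M := by
      intro w s
      have hs := sum_hitWeight (m := 1 / (M : ℝ)) hQ hD0 hD1 (by positivity)
        (div_le_one_of_le₀ hM1 (by positivity)) s y
      split_ifs with hw
      · exact hs
      · have hM2 : M ≠ 1 := by
          rintro rfl
          exact hw (Subsingleton.elim _ _)
        have : (M : ℝ) - 1 ≠ 0 := sub_ne_zero.2 (by exact_mod_cast hM2)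
        rw [← Finset.sum_div, Finset.sum_sub_distrib, hs, sum_inputWeight hQ]
        field_simp
    rw [h, h]

variable (hQ : ∀ s, Q s ∈ stdSimplex ℝ X) (hD0 : ∀ s y x, 0 ≤ D s y x)
  (hD1 : ∀ s y, ∑ x, D s y x ≤ 1) (hM : 0 < M)

lemma causalScheme_isCausal : (causalScheme hQ hD0 hD1 hM n).IsCausal := by
  classical
  have hM1 : (1 : ℝ) ≤ M := by exact_mod_cast hM
  intro i _ _ x w' w s s' y hs
  have h1 := sum_prefix_congr (g := hitWeight Q D (1 / M)) (fun n s y x =>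
    sum_hitWeight_snoc hQ hD0 hD1 (by positivity) (div_le_one_of_le₀ hM1 (by positivity)) s y x)
    i x y hs
  have h2 := sum_prefix_congr (g := fun n s (_ : Fin n → Y) x => inputWeight Q s x)
    (fun n s y x => sum_inputWeight_snoc hQ s x) i x y hs
  simp only [NSScheme.prefixMarginal, causalScheme]
  split_ifs
  · exact h1
  · simp only [← Finset.sum_div, Finset.sum_sub_distrib]
    rw [h1, h2]

lemma hitProb_causalScheme (s : Fin n → S) (y : Fin n → Y) (x : Fin n → X) :
    (causalScheme hQ hD0 hD1 hM n).hitProb s y x = hitWeight Q D (1 / M) n s y x := by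
  have : (M : ℝ) ≠ 0 := by positivity
  simp [NSScheme.hitProb, causalScheme, this]

variable [Fintype Y] [Fintype S]

lemma one_sub_successProb_causalScheme (W : StateChannel X Y S) :
    1 - (causalScheme hQ hD0 hD1 hM n).successProb W =
      ∑ x : Fin n → X, ∑ s : Fin n → S, ∑ y : Fin n → Y,
        (∏ i, W.stateLaw (s i)) * (∏ i, W.kernel (x i) (s i) (y i)) *
          (inputWeight Q s x - hitWeight Q D (1 / M) n s y x) := by
  have h1 : ∑ x : Fin n → X, ∑ s : Fin n → S, ∑ y : Fin n → Y,
      (∏ i, W.stateLaw (s i)) * (∏ i, W.kernel (x i) (s i) (y i)) * inputWeight Q s x = 1 := by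
    rw [Finset.sum_comm]
    have : ∀ (x : Fin n → X) (s : Fin n → S),
        ∑ y : Fin n → Y, ∏ i, W.kernel (x i) (s i) (y i) = 1 := fun x s =>
      sum_prod_eq_one fun i => W.kernel_mem (x i) (s i)
    simp only [← Finset.mul_sum, ← Finset.sum_mul, this, mul_one, sum_inputWeight hQ]
    exact sum_prod_eq_one fun _ => W.stateLaw_mem
  have h2 : (causalScheme hQ hD0 hD1 hM n).successProb W =
      ∑ x : Fin n → X, ∑ s : Fin n → S, ∑ y : Fin n → Y,
        (∏ i, W.stateLaw (s i)) * (∏ i, W.kernel (x i) (s i) (y i)) *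
          hitWeight Q D (1 / M) n s y x := by
    rw [NSScheme.successProb_eq, Finset.sum_comm]
    simp only [hitProb_causalScheme, Finset.mul_sum, mul_assoc]
    exact Finset.sum_congr rfl fun s _ => Finset.sum_comm
  rw [h2, ← h1]
  simp only [← Finset.sum_sub_distrib, mul_sub]

end Scheme

/-! ### Achievability -/

section Achievability

variable {X Y S : Type*} [Fintype X] [Fintype Y] [Fintype S]

/-- Chernoff's bound gives an exponential decay for a variable with negative mean. -/
lemma exists_sum_mul_exp_lt_one {ι : Type*} [Fintype ι] {μ : ι → ℝ} (hμ : ∑ i, μ i = 1)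
    {f : ι → ℝ} (hf : ∑ i, μ i * f i < 0) : ∃ t > 0, ∑ i, μ i * Real.exp (t * f i) < 1 := by
  have hd : HasDerivAt (fun t => ∑ i, μ i * Real.exp (t * f i)) (∑ i, μ i * f i) 0 := by
    refine HasDerivAt.fun_sum fun i _ => ?_
    have h := ((hasDerivAt_id (0 : ℝ)).mul_const (f i)).exp
    simpa using h.const_mul (μ i)
  have ht := (hasDerivAt_iff_tendsto_slope_zero.1 hd).mono_left (nhdsGT_le_nhdsNE 0)
  obtain ⟨t, ht, ht0⟩ := ((ht.eventually_lt_const hf).and self_mem_nhdsWithin).exists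
  refine ⟨t, ht0, ?_⟩
  have ht0 : 0 < t := ht0
  simp only [zero_add, zero_mul, Real.exp_zero, mul_one, hμ, smul_eq_mul] at ht
  rw [← div_eq_inv_mul, div_lt_iff₀ ht0] at ht
  linarith

/-- The posterior law of the input of the channel `W` given the state and the channel output, for
the input law `Q`. For outputs of probability zero it is zero. -/
noncomputable def StateChannel.posterior (W : StateChannel X Y S) (Q : S → X → ℝ) (s : S) (y : Y)
    (x : X) : ℝ := Q s x * W.kernel x s y / outputLaw (fun x => W.kernel x s) (Q s) y

lemma StateChannel.posterior_nonneg (W : StateChannel X Y S) {Q : S → X → ℝ}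
    (hQ : ∀ s, Q s ∈ stdSimplex ℝ X) (s : S) (y : Y) (x : X) : 0 ≤ W.posterior Q s y x :=
  div_nonneg (mul_nonneg ((hQ s).1 x) ((W.kernel_mem x s).1 y))
    ((outputLaw_mem (fun x => W.kernel_mem x s) (hQ s)).1 y)

lemma StateChannel.sum_posterior_le (W : StateChannel X Y S) (Q : S → X → ℝ) (s : S) (y : Y) :
    ∑ x, W.posterior Q s y x ≤ 1 := by
  simp only [StateChannel.posterior, ← Finset.sum_div]
  exact div_self_le_one _

/-- The information density, in nats. -/
noncomputable def StateChannel.infoDensity (W : StateChannel X Y S) (Q : S → X → ℝ) (x : X) (s : S)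
    (y : Y) : ℝ := Real.log (W.kernel x s y / outputLaw (fun x => W.kernel x s) (Q s) y)

/-- Decoding errors are due to sequences whose information density falls short of the rate. -/
lemma StateChannel.mul_sub_hitWeight_le (W : StateChannel X Y S) {Q : S → X → ℝ}
    (hQ : ∀ s, Q s ∈ stdSimplex ℝ X) {M n : ℕ} (hM : 0 < M) {a t : ℝ} (hMa : M ≤ Real.exp (n * a))
    (ht : 0 ≤ t) (x : Fin n → X) (s : Fin n → S) (y : Fin n → Y) :
    (∏ i, W.stateLaw (s i)) * (∏ i, W.kernel (x i) (s i) (y i)) *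
        (inputWeight Q s x - hitWeight Q (W.posterior Q) (1 / M) n s y x) ≤
      ∏ i, W.jointLaw Q (x i) (y i) (s i) *
        Real.exp (t * (a - W.infoDensity Q (x i) (s i) (y i))) := by
  have hM1 : (1 : ℝ) ≤ M := by exact_mod_cast hM
  have hm0 : (0 : ℝ) ≤ 1 / M := by positivity
  have hm1 : 1 / (M : ℝ) ≤ 1 := div_le_one_of_le₀ hM1 (by positivity)
  have hR := hitWeight_nonneg_and_le hQ (W.posterior_nonneg hQ) (W.sum_posterior_le Q) hm0 hm1 s y x
  have hP : 0 ≤ ∏ i, W.stateLaw (s i) := Finset.prod_nonneg fun i _ => W.stateLaw_mem.1 _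
  have hN : 0 ≤ ∏ i, W.kernel (x i) (s i) (y i) :=
    Finset.prod_nonneg fun i _ => (W.kernel_mem _ _).1 _
  have hJ : ∏ i, W.jointLaw Q (x i) (y i) (s i) =
      (∏ i, W.stateLaw (s i)) * (∏ i, W.kernel (x i) (s i) (y i)) * inputWeight Q s x := by
    simp only [StateChannel.jointLaw, inputWeight, ← Finset.prod_mul_distrib]
    exact Finset.prod_congr rfl fun i _ => by ring
  have hJ0 : 0 ≤ ∏ i, W.jointLaw Q (x i) (y i) (s i) :=
    hJ ▸ mul_nonneg (mul_nonneg hP hN) (inputWeight_nonneg hQ s x)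
  have hexp : ∏ i, Real.exp (t * (a - W.infoDensity Q (x i) (s i) (y i))) =
      Real.exp (t * (n * a - ∑ i, W.infoDensity Q (x i) (s i) (y i))) := by
    rw [← Real.exp_sum, ← Finset.mul_sum, Finset.sum_sub_distrib]
    simp
  rw [Finset.prod_mul_distrib, hexp]
  have hle : (∏ i, W.stateLaw (s i)) * (∏ i, W.kernel (x i) (s i) (y i)) *
      (inputWeight Q s x - hitWeight Q (W.posterior Q) (1 / M) n s y x) ≤
      ∏ i, W.jointLaw Q (x i) (y i) (s i) := by
    rw [hJ]
    exact mul_le_mul_of_nonneg_left (by linarith [hR.1]) (mul_nonneg hP hN)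
  by_cases h0 : ∏ i, W.jointLaw Q (x i) (y i) (s i) = 0
  · rw [h0] at hle ⊢
    simpa using hle
  rcases le_total (∑ i, W.infoDensity Q (x i) (s i) (y i)) (n * a) with hd | hd
  · exact hle.trans (le_mul_of_one_le_right hJ0
      (Real.one_le_exp (mul_nonneg ht (sub_nonneg.2 hd))))
  -- on the remaining sequences the posterior exceeds the input law by the factor `M`
  suffices h : inputWeight Q s x ≤ hitWeight Q (W.posterior Q) (1 / M) n s y x from
    (mul_nonpos_of_nonneg_of_nonpos (mul_nonneg hP hN) (sub_nonpos.2 h)).trans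
      (mul_nonneg hJ0 (Real.exp_pos _).le)
  rcases hitWeight_eq_or_le hQ (W.posterior_nonneg hQ) (W.sum_posterior_le Q) hm0 hm1 s y x
    with h | h
  · exact h.ge
  refine le_trans ?_ h
  have hne : ∀ i, Q (s i) (x i) * W.kernel (x i) (s i) (y i) ≠ 0 := fun i hi =>
    h0 (Finset.prod_eq_zero (Finset.mem_univ i) (by
      rw [StateChannel.jointLaw, mul_assoc, hi, mul_zero]))
  have hout : ∀ i, 0 < outputLaw (fun x => W.kernel x (s i)) (Q (s i)) (y i) := fun i =>
    outputLaw_pos (K := fun x => W.kernel x (s i)) (fun x y => (W.kernel_mem x _).1 y) (hQ (s i)).1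
      (hne i)
  have hpost : ∏ i, W.posterior Q (s i) (y i) (x i) =
      inputWeight Q s x * Real.exp (∑ i, W.infoDensity Q (x i) (s i) (y i)) := by
    rw [Real.exp_sum, inputWeight, ← Finset.prod_mul_distrib]
    refine Finset.prod_congr rfl fun i _ => ?_
    have hk : 0 < W.kernel (x i) (s i) (y i) :=
      lt_of_le_of_ne ((W.kernel_mem _ _).1 _) (right_ne_zero_of_mul (hne i)).symm
    rw [StateChannel.infoDensity, Real.exp_log (div_pos hk (hout i)), StateChannel.posterior,
      mul_div_assoc]
  have hMe := hMa.trans (Real.exp_le_exp.2 hd)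
  rw [hpost, one_div, inv_mul_eq_div, le_div_iff₀ (by positivity)]
  exact mul_le_mul_of_nonneg_left hMe (inputWeight_nonneg hQ s x)

lemma StateChannel.sum_jointLaw (W : StateChannel X Y S) {Q : S → X → ℝ}
    (hQ : ∀ s, Q s ∈ stdSimplex ℝ X) : ∑ x, ∑ s, ∑ y, W.jointLaw Q x y s = 1 := by
  simp only [StateChannel.jointLaw, ← Finset.mul_sum, (W.kernel_mem _ _).2, mul_one]
  rw [Finset.sum_comm]
  simp [← Finset.mul_sum, (hQ _).2, W.stateLaw_mem.2]

lemma StateChannel.sum_jointLaw_mul_infoDensity (W : StateChannel X Y S) {Q : S → X → ℝ}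
    (hQ : ∀ s, Q s ∈ stdSimplex ℝ X) :
    ∑ x, ∑ s, ∑ y, W.jointLaw Q x y s * W.infoDensity Q x s y =
      condMutualInfo (W.jointLaw Q) * Real.log 2 := by
  rw [condMutualInfo_jointLaw W hQ, div_mul_cancel₀ _ (Real.log_pos one_lt_two).ne',
    Finset.sum_comm]
  simp only [mutualInfo, divergence, Finset.mul_sum, StateChannel.jointLaw,
    StateChannel.infoDensity, mul_assoc]

/-- The error probability of the causal schemes decays exponentially below the information rate. -/
lemma StateChannel.exists_one_sub_successProb_le (W : StateChannel X Y S) {Q : S → X → ℝ}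
    (hQ : ∀ s, Q s ∈ stdSimplex ℝ X) {R : ℝ} (hR : R < condMutualInfo (W.jointLaw Q)) :
    ∃ r, 0 ≤ r ∧ r < 1 ∧ ∀ (M n : ℕ) (hM : 0 < M), (M : ℝ) ≤ Real.exp (n * (R * Real.log 2)) →
      1 - (causalScheme hQ (W.posterior_nonneg hQ) (W.sum_posterior_le Q) hM n).successProb W ≤
        r ^ n := by
  have hlog := Real.log_pos one_lt_two
  have hJ0 : ∀ x y s, 0 ≤ W.jointLaw Q x y s := fun x y s =>
    mul_nonneg (mul_nonneg (W.stateLaw_mem.1 s) ((hQ s).1 x)) ((W.kernel_mem x s).1 y)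
  obtain ⟨t, ht0, ht⟩ := exists_sum_mul_exp_lt_one
    (μ := fun z : X × S × Y => W.jointLaw Q z.1 z.2.2 z.2.1)
    (f := fun z => R * Real.log 2 - W.infoDensity Q z.1 z.2.1 z.2.2)
    (by simpa only [Fintype.sum_prod_type] using W.sum_jointLaw hQ)
    (by
      simp only [Fintype.sum_prod_type, mul_sub, Finset.sum_sub_distrib,
        W.sum_jointLaw_mul_infoDensity hQ]
      simp only [← Finset.sum_mul, W.sum_jointLaw hQ, one_mul, sub_neg]
      exact mul_lt_mul_of_pos_right hR hlog)
  simp only [Fintype.sum_prod_type] at ht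
  refine ⟨_, ?_, ht, fun M n hM hMa => ?_⟩
  · exact Finset.sum_nonneg fun x _ => Finset.sum_nonneg fun s _ => Finset.sum_nonneg fun y _ =>
      mul_nonneg (hJ0 x y s) (Real.exp_pos _).le
  · rw [one_sub_successProb_causalScheme, ← sum_sum_sum_prod fun x s y => W.jointLaw Q x y s *
      Real.exp (t * (R * Real.log 2 - W.infoDensity Q x s y))]
    exact Finset.sum_le_sum fun x _ => Finset.sum_le_sum fun s _ => Finset.sum_le_sum fun y _ =>
      W.mul_sub_hitWeight_le hQ hM hMa ht0.le x s y

lemma successProb_causalScheme_le_one (W : StateChannel X Y S) {Q : S → X → ℝ}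
    {D : S → Y → X → ℝ} {M : ℕ} (hQ : ∀ s, Q s ∈ stdSimplex ℝ X) (hD0 : ∀ s y x, 0 ≤ D s y x)
    (hD1 : ∀ s y, ∑ x, D s y x ≤ 1) (hM : 0 < M) (n : ℕ) :
    (causalScheme hQ hD0 hD1 hM n).successProb W ≤ 1 := by
  have hM1 : (1 : ℝ) ≤ M := by exact_mod_cast hM
  rw [← sub_nonneg, one_sub_successProb_causalScheme]
  refine Finset.sum_nonneg fun x _ => Finset.sum_nonneg fun s _ => Finset.sum_nonneg fun y _ =>
    mul_nonneg (mul_nonneg (Finset.prod_nonneg fun i _ => W.stateLaw_mem.1 _)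
      (Finset.prod_nonneg fun i _ => (W.kernel_mem _ _).1 _)) (sub_nonneg.2 ?_)
  exact (hitWeight_nonneg_and_le hQ hD0 hD1 (by positivity)
    (div_le_one_of_le₀ hM1 (by positivity)) s y x).2

lemma tendsto_logb_floor_exp_div {R : ℝ} (hR : 0 ≤ R) :
    Tendsto (fun n : ℕ => Real.logb 2 (⌊Real.exp (n * (R * Real.log 2))⌋₊ : ℕ) / n) atTop
      (𝓝 R) := by
  have hlog := Real.log_pos one_lt_two
  have hlow : Tendsto (fun n : ℕ => R - 1 / n) atTop (𝓝 (R - 0)) :=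
    (tendsto_const_div_atTop_nhds_zero_nat _).const_sub R
  rw [sub_zero] at hlow
  refine tendsto_of_tendsto_of_tendsto_of_le_of_le' hlow tendsto_const_nhds ?_ ?_ <;>
    filter_upwards [eventually_gt_atTop 0] with n hn
  all_goals
    have hn' : (0 : ℝ) < n := by exact_mod_cast hn
    set z := Real.exp (n * (R * Real.log 2)) with hz
    have hz1 : 1 ≤ z := Real.one_le_exp (by positivity)
    have hfl : (1 : ℝ) ≤ ⌊z⌋₊ := by exact_mod_cast (Nat.one_le_floor_iff z).2 hz1
  · have h1 : z / 2 ≤ ⌊z⌋₊ := by linarith [Nat.lt_floor_add_one z]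
    have h2 := Real.log_le_log (by positivity) h1
    rw [Real.log_div (by positivity) two_ne_zero, hz, Real.log_exp] at h2
    rw [← hz] at h2
    rw [Real.logb, div_div, le_div_iff₀ (by positivity)]
    have : (R - 1 / n) * (Real.log 2 * n) = n * (R * Real.log 2) - Real.log 2 := by field_simp
    linarith
  · have h2 := Real.log_le_log (by linarith) (Nat.floor_le (zero_le_one.trans hz1))
    rw [hz, Real.log_exp, ← hz] at h2
    rw [Real.logb, div_div, div_le_iff₀ (by positivity)]
    linarith

theorem StateChannel.isAchievable_causal (W : StateChannel X Y S) {Q : S → X → ℝ}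
    (hQ : ∀ s, Q s ∈ stdSimplex ℝ X) {R : ℝ} (hR0 : 0 ≤ R)
    (hR : R < condMutualInfo (W.jointLaw Q)) : W.IsAchievable CSIT.causal R := by
  obtain ⟨r, hr0, hr1, hr⟩ := W.exists_one_sub_successProb_le hQ hR
  have hlog := Real.log_pos one_lt_two
  have hM : ∀ n : ℕ, 0 < ⌊Real.exp (n * (R * Real.log 2))⌋₊ := fun n =>
    Nat.floor_pos.2 (Real.one_le_exp (by positivity))
  refine ⟨hR0, _, fun n => causalScheme hQ (W.posterior_nonneg hQ) (W.sum_posterior_le Q) (hM n) n,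
    hM, fun n => causalScheme_isCausal _ _ _ _, ?_, R,
    (continuous_coe_real_ereal.tendsto R).comp (tendsto_logb_floor_exp_div hR0), le_rfl⟩
  have h : Tendsto (fun n : ℕ => 1 - r ^ n) atTop (𝓝 (1 - 0)) :=
    (tendsto_pow_atTop_nhds_zero_of_lt_one hr0 hr1).const_sub 1
  rw [sub_zero] at h
  refine tendsto_of_tendsto_of_tendsto_of_le_of_le h tendsto_const_nhds (fun n => ?_)
    fun n => successProb_causalScheme_le_one W ..
  have := hr _ n (hM n) (Nat.floor_le (Real.exp_pos _).le)
  linarith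

/-- With a single message decoding is always correct. -/
lemma StateChannel.isAchievable_zero [Nonempty X] (W : StateChannel X Y S) :
    W.IsAchievable CSIT.causal 0 := by
  classical
  have hQ : ∀ _ : S, Pi.single (Classical.arbitrary X) (1 : ℝ) ∈ stdSimplex ℝ X :=
    fun _ => single_mem_stdSimplex ℝ _
  have hD0 : ∀ (_ : S) (_ : Y) (_ : X), (0 : ℝ) ≤ 0 := fun _ _ _ => le_rfl
  have hD1 : ∀ (_ : S) (_ : Y), ∑ _x : X, (0 : ℝ) ≤ 1 := fun _ _ => by simp
  refine ⟨le_rfl, fun _ => 1, fun n => causalScheme hQ hD0 hD1 one_pos n, fun _ => one_pos,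
    fun n => causalScheme_isCausal _ _ _ _, ?_, 0, by simp, le_rfl⟩
  refine tendsto_const_nhds.congr fun n => ?_
  have h := one_sub_successProb_causalScheme hQ hD0 hD1 one_pos (n := n) W
  simp only [Nat.cast_one, div_one, hitWeight_one hQ hD0 hD1, sub_self, mul_zero,
    Finset.sum_const_zero] at h
  linarith

end Achievability

/-! ### The capacity -/

lemma StateChannel.IsAchievable.of_causal {X Y S : Type*} [Fintype X] [Fintype Y] [Fintype S]
    {W : StateChannel X Y S} {R : ℝ} (h : W.IsAchievable CSIT.causal R) (c : CSIT) :
    W.IsAchievable c R := by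
  cases c with
  | causal => exact h
  | noncausal =>
    obtain ⟨h0, M, Z, hM, -, h⟩ := h
    exact ⟨h0, M, Z, hM, fun _ => trivial, h⟩

theorem isNSCapacity_of_isGreatest {X Y S : Type*} [Fintype X] [Nonempty X] [Fintype Y] [Fintype S]
    {W : StateChannel X Y S} {C : ℝ} (hC : IsGreatest W.infoValues C) (c : CSIT) :
    W.IsNSCapacity c C := by
  obtain ⟨C', hC', hconv⟩ := exists_isGreatest_infoValues W
  obtain rfl := hC.unique hC'
  refine ⟨fun R hR => hR.le hconv, fun B hB => ?_⟩
  obtain ⟨Q, hQ, hCQ⟩ := hC.1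
  have hB0 : 0 ≤ B := hB (W.isAchievable_zero.of_causal c)
  by_contra! hlt
  obtain ⟨R, hBR, hRC⟩ := exists_between hlt
  exact hBR.not_ge
    (hB ((W.isAchievable_causal hQ (hB0.trans hBR.le) (hCQ ▸ hRC)).of_causal c))

end NSCoding

/-- For every finite channel with state, the non-signaling-assisted capacity with causal CSIT is
`max_{P_{X|S}} I(X;Y|S)` (the maximum is attained); it equals the non-signaling-assisted capacity
with non-causal CSIT, and both are unchanged if the receiver is also given the state. -/
theorem theorem1 {X Y S : Type*} [Fintype X] [Nonempty X] [Fintype Y] [Fintype S]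
    (W : NSCoding.StateChannel X Y S) :
    ∃ C : ℝ, IsGreatest W.infoValues C ∧
      W.IsNSCapacity NSCoding.CSIT.causal C ∧
      W.IsNSCapacity NSCoding.CSIT.noncausal C ∧
      W.withCSIR.IsNSCapacity NSCoding.CSIT.causal C ∧
      W.withCSIR.IsNSCapacity NSCoding.CSIT.noncausal C := by
  obtain ⟨C, hC, -⟩ := NSCoding.exists_isGreatest_infoValues W
  have hC' : IsGreatest W.withCSIR.infoValues C := by rwa [NSCoding.infoValues_withCSIR]
  exact ⟨C, hC, NSCoding.isNSCapacity_of_isGreatest hC _, NSCoding.isNSCapacity_of_isGreatest hC _,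
    NSCoding.isNSCapacity_of_isGreatest hC' _, NSCoding.isNSCapacity_of_isGreatest hC' _⟩
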